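/- All graphs are finite and simple. For positive integers $p,q$ with $p/q\ge 2$ let $G_{p,q}$ be the graph with vertex set $\{0,\dots,p-1\}$ in which $a,b$ are adjacent if and only if $q\le |a-b|\le p-q$. A graph $G$ is $(p,q)$-mixing if the graph $\mathrm{Col}(G,G_{p,q})$ is connected (in particular non-empty), where the vertices of $\mathrm{Col}(G,G_{p,q})$ are the homomorphisms $G\to G_{p,q}$, and two of them are adjacent if they differ on at most one vertex of $G$. If $x,y$ are vertices of $G$ at distance $2$, the elementary fold at $x,y$ is the quotient homomorphism $G\to G_{xy}$ onto the simple graph $G_{xy}$ obtained from $G$ by identifying $x$ and $y$. A graph $G$ folds to a graph $H$ if some composition of finitely many (possibly zero) elementary folds, starting at $G$, ends in a graph isomorphic to $H$. Let $p,q$ be positive integers with $2<\frac pq<4$. (i) If $G$ folds to $H$ and $H$ is not $(p,q)$-mixing, then $G$ is not $(p,q)$-mixing. (ii) If $p=2q+1$, then a connected bipartite graph $G$ is $(p,q)$-mixing if and only if $G$ does not fold to the cycle $C_{4q+2}$. -/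

import Mathlib

universe u v

namespace CircularMixing

/-- The circular clique `G_{p,q}`: vertices `0, …, p-1`, with `a` and `b` adjacent iff
`q ≤ |a - b| ≤ p - q`. The condition `a ≠ b` is implied when `q` is positive. -/
def circularClique (p q : ℕ) : SimpleGraph (Fin p) where
  Adj a b := a ≠ b ∧ (q : ℤ) ≤ |(a : ℤ) - (b : ℤ)| ∧ |(a : ℤ) - (b : ℤ)| ≤ (p : ℤ) - (q : ℤ)
  symm := ⟨fun a b h => ⟨h.1.symm, by rw [abs_sub_comm]; exact h.2⟩⟩
  loopless := ⟨fun _ h => h.1 rfl⟩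

/-- The reconfiguration graph `Col(G, K)`: its vertices are the homomorphisms `G → K`, two distinct
ones being adjacent iff they differ on at most one vertex. (The loops are omitted; they do not
matter for connectedness.) -/
def colGraph {V : Type u} {W : Type v} (G : SimpleGraph V) (K : SimpleGraph W) :
    SimpleGraph (G →g K) where
  Adj f g := f ≠ g ∧ {x : V | f x ≠ g x}.Subsingleton
  symm := ⟨fun f g h => ⟨h.1.symm, by simpa only [ne_comm] using h.2⟩⟩
  loopless := ⟨fun _ h => h.1 rfl⟩

/-- `G` is `K`-mixing: there is a homomorphism `G → K`, and any two of them are joined by a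
path in `Col(G, K)`. -/
def IsHomMixing {V : Type u} {W : Type v} (G : SimpleGraph V) (K : SimpleGraph W) : Prop :=
  (colGraph G K).Connected

/-- `G` is `(p,q)`-mixing. -/
def IsMixing {V : Type u} (p q : ℕ) (G : SimpleGraph V) : Prop :=
  IsHomMixing G (circularClique p q)

/-- The vertex set of `G_{xy}`: the quotient of `V` by the identification of `x` with `y`. -/
abbrev Identified {V : Type u} (x y : V) : Type u :=
  Quot (fun a b : V => a = x ∧ b = y)

/-- The graph `G_{xy}` obtained from `G` by identifying `x` and `y`: two distinct vertices of the
quotient are adjacent iff they have adjacent representatives. -/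
def identify {V : Type u} (G : SimpleGraph V) (x y : V) : SimpleGraph (Identified x y) :=
  G.map (Quot.mk _)

theorem mk_eq_mk {V : Type u} {x y a b : V}
    (h : (Quot.mk _ a : Identified x y) = Quot.mk _ b) :
    a = b ∨ (a = x ∧ b = y) ∨ (a = y ∧ b = x) := by
  have h' := Quot.eqvGen_exact h
  clear h
  induction h' with
  | rel a b h => exact Or.inr (Or.inl h)
  | refl a => exact Or.inl rfl
  | symm a b _ ih => grind
  | trans a b c _ _ ih1 ih2 => grind

/-- The elementary fold `G → G_{xy}` at two vertices `x`, `y` at distance `2`. -/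
def elementaryFold {V : Type u} (G : SimpleGraph V) (x y : V) (hxy : G.dist x y = 2) :
    G →g identify G x y where
  toFun := Quot.mk _
  map_rel' := by
    intro a b hab
    have hn : ¬ G.Adj x y := fun h => by
      rw [← SimpleGraph.dist_eq_one_iff_adj] at h
      omega
    refine ⟨fun h => ?_, a, b, hab, rfl, rfl⟩
    rcases mk_eq_mk h with h | ⟨rfl, rfl⟩ | ⟨rfl, rfl⟩
    · exact G.loopless.irrefl _ (h ▸ hab)
    · exact hn hab
    · exact hn hab.symm

/-- The foldings onto `H`: finite (possibly empty) compositions of elementary folds, followed by an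
isomorphism of the resulting graph with `H`. -/
inductive IsFolding {W : Type v} {H : SimpleGraph W} :
    {V : Type u} → {G : SimpleGraph V} → (G →g H) → Prop
  | iso {V : Type u} {G : SimpleGraph V} (e : G ≃g H) : IsFolding e.toHom
  | comp {V : Type u} {G : SimpleGraph V} (x y : V) (hxy : G.dist x y = 2)
      (f : identify G x y →g H) :
      IsFolding f → IsFolding (f.comp (elementaryFold G x y hxy))

/-- `G` folds to `H`. -/
def FoldsTo {V : Type u} {W : Type v} (G : SimpleGraph V) (H : SimpleGraph W) : Prop :=
  ∃ f : G →g H, IsFolding f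

end CircularMixing

open SimpleGraph

namespace CircularMixing

/-! A colouring `f` assigns to each oriented edge the integer `displacement`, an antisymmetric
1-cochain; its sum round a closed walk is the wind. Since `p < 4 * q`, recolouring one vertex
changes this cochain by a coboundary (`displacement_sub_eq`), so wind is invariant under
reconfiguration. Reflecting the colours negates it, so in a mixing graph every wind is zero, which
moreover forces bipartiteness. Conversely, colourings of a bipartite graph without wind lift to
integer functions, and any two lifts are joined by unit moves because `2 * q < p`
(`IsLift.exists_lower`). Hence mixing is equivalent to `IsWindless`.

(i) Windlessness passes to folds: a potential for the pulled-back colouring agrees at two vertices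
with a common neighbour and the same colour.

(ii) For `p = 2 * q + 1` displacements are `±1`, so a colouring with wind, combined with a
bipartition, is an essential map to the cycle of length `4 * q + 2`. A connected graph with such a
map folds to the cycle (`foldsTo_cycleGraph`), and the cycle itself carries a colouring with wind.
-/

/-! ### Displacement, wind and their invariance under reconfiguration. -/

/-- Twice the clockwise displacement from the colour `a` to the colour `b`, recentred so that it is
antisymmetric. -/
def displacement {p : ℕ} (a b : Fin p) : ℤ := 2 * (((b : ℤ) - (a : ℤ)) % (p : ℤ)) - p

/-- The colouring `f` has no wind: its displacements are the differences of a function on the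
vertices. -/
def HasPotential {V : Type u} {G : SimpleGraph V} {p q : ℕ} (f : G →g circularClique p q) : Prop :=
  ∃ F : V → ℤ, ∀ u v, G.Adj u v → F v - F u = displacement (f u) (f v)

/-- `G` is bipartite and none of its `(p,q)`-colourings has wind. -/
def IsWindless {V : Type u} (p q : ℕ) (G : SimpleGraph V) : Prop :=
  G.IsBipartite ∧ ∀ f : G →g circularClique p q, HasPotential f

theorem sub_emod_cases {p : ℕ} (a b : Fin p) :
    ((a : ℤ) ≤ b ∧ ((b : ℤ) - a) % p = b - a) ∨ ((b : ℤ) < a ∧ ((b : ℤ) - a) % p = b - a + p) := by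
  have ha := a.isLt
  have hb := b.isLt
  rcases le_or_gt (a : ℤ) b with h | h
  · exact Or.inl ⟨h, Int.emod_eq_of_lt (by omega) (by omega)⟩
  · refine Or.inr ⟨h, ?_⟩
    rw [← Int.add_emod_right, Int.emod_eq_of_lt (by omega) (by omega)]

theorem circularClique_adj_iff {p q : ℕ} (hq : 0 < q) (a b : Fin p) :
    (circularClique p q).Adj a b ↔
      (q : ℤ) ≤ ((b : ℤ) - a) % p ∧ ((b : ℤ) - a) % p ≤ (p : ℤ) - q := by
  have ha := a.isLt
  have hb := b.isLt
  change (a ≠ b ∧ _ ∧ _) ↔ _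
  rw [Ne, Fin.ext_iff]
  rcases sub_emod_cases a b with ⟨h, e⟩ | ⟨h, e⟩ <;> rw [e]
  · rw [abs_of_nonpos (by omega)]; omega
  · rw [abs_of_nonneg (by omega)]; omega

theorem displacement_antisymm {p : ℕ} {a b : Fin p} (h : a ≠ b) :
    displacement b a = - displacement a b := by
  unfold displacement
  rw [Ne, Fin.ext_iff] at h
  rcases sub_emod_cases a b with ⟨h1, e1⟩ | ⟨h1, e1⟩ <;>
  rcases sub_emod_cases b a with ⟨h2, e2⟩ | ⟨h2, e2⟩ <;> rw [e1, e2] <;> omega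

theorem displacement_rev {p : ℕ} (a b : Fin p) :
    displacement a.rev b.rev = displacement b a := by
  unfold displacement
  have ha := a.isLt
  have hb := b.isLt
  rw [Fin.val_rev, Fin.val_rev]
  congr 3
  omega

/-- The alternating sum round the 4-cycle `a c b d` is a multiple of `2 * p`, while each term has
absolute value at most `p - 2 * q`. As `4 * (p - 2 * q) < 2 * p`, the sum vanishes. -/
theorem displacement_sub_eq {p q : ℕ} (hq : 0 < q) (h4 : p < 4 * q) {a b c d : Fin p}
    (hac : (circularClique p q).Adj a c) (had : (circularClique p q).Adj a d)
    (hbc : (circularClique p q).Adj b c) (hbd : (circularClique p q).Adj b d) :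
    displacement a d - displacement a c = displacement b d - displacement b c := by
  rw [circularClique_adj_iff hq] at hac had hbc hbd
  unfold displacement
  rcases sub_emod_cases a c with ⟨_, e1⟩ | ⟨_, e1⟩ <;>
  rcases sub_emod_cases a d with ⟨_, e2⟩ | ⟨_, e2⟩ <;>
  rcases sub_emod_cases b c with ⟨_, e3⟩ | ⟨_, e3⟩ <;>
  rcases sub_emod_cases b d with ⟨_, e4⟩ | ⟨_, e4⟩ <;>
  rw [e1] at hac ⊢ <;> rw [e2] at had ⊢ <;> rw [e3] at hbc ⊢ <;> rw [e4] at hbd ⊢ <;> omega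

/-- Reconfiguration changes the displacements by a coboundary. -/
theorem exists_displacement_sub_of_adj {V : Type u} {G : SimpleGraph V} {p q : ℕ} (hq : 0 < q)
    (h4 : p < 4 * q) {f g : G →g circularClique p q} (h : (colGraph G _).Adj f g) :
    ∃ D : V → ℤ, ∀ u v, G.Adj u v →
      displacement (g u) (g v) - displacement (f u) (f v) = D v - D u := by
  classical
  obtain ⟨hne, hs⟩ := h
  obtain ⟨x, hx⟩ : ∃ x, f x ≠ g x := by
    by_contra! hc
    exact hne (DFunLike.ext _ _ hc)
  have hoff : ∀ v, v ≠ x → g v = f v := by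
    intro v hv
    by_contra hc
    exact hv (hs (show f v ≠ g v from fun h => hc h.symm) hx)
  -- The change at the recoloured vertex is the same seen from every neighbour, so it is the
  -- coboundary of `c` times the indicator of `x`.
  obtain ⟨c, hc⟩ : ∃ c : ℤ, ∀ u, G.Adj u x →
      displacement (f u) (g x) - displacement (f u) (f x) = c := by
    by_cases hu : ∃ u, G.Adj u x
    · obtain ⟨u, hu⟩ := hu
      refine ⟨_, fun w hw => displacement_sub_eq hq h4 (f.map_adj hw) ?_ (f.map_adj hu) ?_⟩
      · rw [← hoff w hw.ne]; exact g.map_adj hw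
      · rw [← hoff u hu.ne]; exact g.map_adj hu
    · exact ⟨0, fun u h => (hu ⟨u, h⟩).elim⟩
  refine ⟨fun v => if v = x then c else 0, fun u v huv => ?_⟩
  by_cases hv : v = x
  · subst hv
    simp only [if_pos, if_neg huv.ne, sub_zero]
    rw [hoff u huv.ne, hc u huv]
  · by_cases hux : u = x
    · subst hux
      simp only [if_pos, if_neg hv, zero_sub]
      rw [← hc v huv.symm, displacement_antisymm (g.map_adj huv.symm).ne,
        displacement_antisymm (f.map_adj huv.symm).ne, hoff v hv]
      ring
    · simp [hv, hux, hoff]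

theorem exists_displacement_sub_of_reachable {V : Type u} {G : SimpleGraph V} {p q : ℕ}
    (hq : 0 < q) (h4 : p < 4 * q) {f g : G →g circularClique p q}
    (h : (colGraph G _).Reachable f g) :
    ∃ D : V → ℤ, ∀ u v, G.Adj u v →
      displacement (g u) (g v) - displacement (f u) (f v) = D v - D u := by
  obtain ⟨w⟩ := h
  induction w with
  | nil => exact ⟨0, by simp⟩
  | cons h _ ih =>
    obtain ⟨D, hD⟩ := ih
    obtain ⟨E, hE⟩ := exists_displacement_sub_of_adj hq h4 h
    refine ⟨fun v => D v + E v, fun u v huv => ?_⟩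
    have h1 := hD u v huv
    have h2 := hE u v huv
    linarith

/-- The reflection of a circular clique. -/
def reflection {p q : ℕ} : circularClique p q →g circularClique p q where
  toFun := Fin.rev
  map_rel' := by
    rintro a b ⟨h1, h2, h3⟩
    have ha := a.isLt
    have hb := b.isLt
    have e : ((a.rev : Fin p) : ℤ) - ((b.rev : Fin p) : ℤ) = -((a : ℤ) - b) := by
      rw [Fin.val_rev, Fin.val_rev]; omega
    refine ⟨fun h => h1 (Fin.rev_injective h), ?_⟩
    rw [e, abs_neg]
    exact ⟨h2, h3⟩

theorem IsMixing.hasPotential {V : Type u} {G : SimpleGraph V} {p q : ℕ} (hq : 0 < q)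
    (h4 : p < 4 * q) (h : IsMixing p q G) (f : G →g circularClique p q) : HasPotential f := by
  obtain ⟨D, hD⟩ := exists_displacement_sub_of_reachable hq h4
    (h.preconnected f (reflection.comp f))
  -- Along an edge `D` changes by `-2` times the displacement, an even number, so floor division
  -- halves the difference exactly.
  refine ⟨fun v => -(D v / 2), fun u v huv => ?_⟩
  have h1 := hD u v huv
  have h2 : displacement (reflection.comp f u) (reflection.comp f v)
      = displacement (f v) (f u) := displacement_rev (f u) (f v)
  rw [h2, displacement_antisymm (f.map_adj huv).ne] at h1
  dsimp only
  omega

/-- Along an edge `F - 2 * f` changes by an odd multiple of `p`, so the parity of its quotient by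
`p` is a 2-colouring. -/
theorem HasPotential.isBipartite {V : Type u} {G : SimpleGraph V} {p q : ℕ} (hp : 0 < p)
    {f : G →g circularClique p q} (h : HasPotential f) : G.IsBipartite := by
  obtain ⟨F, hF⟩ := h
  have key : ∀ u v, G.Adj u v → ∃ k : ℤ,
      F v - 2 * (f v : ℤ) = F u - 2 * (f u : ℤ) + (2 * k + 1) * p := by
    intro u v huv
    have h1 := hF u v huv
    unfold displacement at h1
    rcases sub_emod_cases (f u) (f v) with ⟨_, e⟩ | ⟨_, e⟩ <;> rw [e] at h1
    · exact ⟨-1, by linarith⟩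
    · exact ⟨0, by linarith⟩
  let c : V → Bool := fun v => decide ((F v - 2 * (f v : ℤ)) / p % 2 = 0)
  have hc : ∀ u v, G.Adj u v → c u ≠ c v := by
    intro u v huv
    obtain ⟨k, hk⟩ := key u v huv
    have : (F v - 2 * (f v : ℤ)) / p = (F u - 2 * (f u : ℤ)) / p + (2 * k + 1) := by
      rw [hk, Int.add_mul_ediv_right _ _ (by omega)]
    simp only [c, ne_eq, decide_eq_decide]
    omega
  exact (Coloring.mk c (fun {u v} => hc u v)).colorable

theorem IsMixing.isWindless {V : Type u} {G : SimpleGraph V} {p q : ℕ} (hq : 0 < q)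
    (h2 : 2 * q < p) (h4 : p < 4 * q) (h : IsMixing p q G) : IsWindless p q G := by
  obtain ⟨f⟩ := h.nonempty
  exact ⟨(h.hasPotential hq h4 f).isBipartite (by omega), h.hasPotential hq h4⟩

/-! ### Integer lifts: absence of wind implies mixing. -/

theorem IsBipartite.exists_int_coloring {V : Type u} {G : SimpleGraph V} (h : G.IsBipartite) :
    ∃ c : V → ℤ, (∀ v, c v = 0 ∨ c v = 1) ∧ ∀ u v, G.Adj u v → c u ≠ c v := by
  obtain ⟨c⟩ := h
  refine ⟨fun v => ((c v : ℕ) : ℤ), fun v => ?_, fun u v huv => ?_⟩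
  · have := (c v).isLt
    dsimp only; omega
  · have := c.valid huv
    rw [Ne, Fin.ext_iff] at this
    dsimp only; omega

/-- An integer-valued lift of a `(p,q)`-colouring of a graph with bipartition `c`. -/
def IsLift {V : Type u} (G : SimpleGraph V) (p q : ℕ) (c : V → ℤ) (L : V → ℤ) : Prop :=
  ∀ u v, G.Adj u v → c u = 0 → c v = 1 → (q : ℤ) ≤ L v - L u ∧ L v - L u ≤ (p : ℤ) - q

/-- The colour of the integer `n` in the circular clique on `p` vertices. -/
def residue {p : ℕ} (hp : 0 < p) (n : ℤ) : Fin p :=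
  ⟨(n % p).toNat, by
    have := Int.emod_nonneg n (b := p) (by omega)
    have := Int.emod_lt_of_pos n (b := p) (by omega)
    omega⟩

theorem val_residue {p : ℕ} (hp : 0 < p) (n : ℤ) : ((residue hp n : Fin p) : ℤ) = n % p :=
  Int.toNat_of_nonneg (Int.emod_nonneg n (by omega))

theorem adj_residue {p q : ℕ} (hp : 0 < p) (hq : 0 < q) {m n : ℤ} (h1 : (q : ℤ) ≤ n - m)
    (h2 : n - m ≤ (p : ℤ) - q) :
    (circularClique p q).Adj (residue hp m) (residue hp n) := by
  rw [circularClique_adj_iff hq, val_residue, val_residue, ← Int.sub_emod,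
    Int.emod_eq_of_lt (by omega) (by omega)]
  exact ⟨h1, h2⟩

/-- The colouring with a given lift. -/
def IsLift.toHom {V : Type u} {G : SimpleGraph V} {p q : ℕ} (hp : 0 < p) (hq : 0 < q) {c : V → ℤ}
    (hc : ∀ v, c v = 0 ∨ c v = 1) (hc' : ∀ u v, G.Adj u v → c u ≠ c v) {L : V → ℤ}
    (hL : IsLift G p q c L) : G →g circularClique p q where
  toFun v := residue hp (L v)
  map_rel' := by
    intro u v huv
    have := hc' u v huv
    rcases hc u with hu | hu <;> rcases hc v with hv | hv
    · omega
    · exact adj_residue hp hq (hL u v huv hu hv).1 (hL u v huv hu hv).2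
    · exact (adj_residue hp hq (hL v u huv.symm hv hu).1 (hL v u huv.symm hv hu).2).symm
    · omega

theorem HasPotential.exists_isLift {V : Type u} {G : SimpleGraph V} {p q : ℕ} (hp : 0 < p)
    (hq : 0 < q) {c : V → ℤ} {f : G →g circularClique p q} (h : HasPotential f) :
    ∃ L : V → ℤ, IsLift G p q c L ∧ ∀ v, f v = residue hp (L v) := by
  obtain ⟨F, hF⟩ := h
  -- Twice the lift should be `F + p * c`, up to a constant on each component. The remainder modulo
  -- `2 * p` is that constant (`hloc`), which spares choosing base points.
  have hval : ∀ v, ∃ k : ℤ, F v + p * c v + (2 * (f v : ℤ) - F v - p * c v) % (2 * p)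
      = 2 * ((f v : ℤ) + p * k) := by
    intro v
    have := Int.emod_add_mul_ediv (2 * (f v : ℤ) - F v - p * c v) (2 * p)
    refine ⟨-((2 * (f v : ℤ) - F v - p * c v) / (2 * p)), ?_⟩
    linarith
  choose k hk using hval
  refine ⟨fun v => (f v : ℤ) + p * k v, ?_, ?_⟩
  · intro u v huv hu hv
    have hloc : (2 * (f v : ℤ) - F v - p * c v) % (2 * p)
        = (2 * (f u : ℤ) - F u - p * c u) % (2 * p) := by
      rw [Int.emod_eq_emod_iff_emod_sub_eq_zero, hu, hv]
      apply Int.emod_eq_zero_of_dvd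
      have h1 := hF u v huv
      unfold displacement at h1
      rcases sub_emod_cases (f u) (f v) with ⟨_, e⟩ | ⟨_, e⟩ <;> rw [e] at h1
      · exact ⟨0, by linarith⟩
      · exact ⟨-1, by linarith⟩
    have h1 := hF u v huv
    have h2 := (circularClique_adj_iff hq _ _).1 (f.map_adj huv)
    unfold displacement at h1
    have hku := hk u
    have hkv := hk v
    rw [hloc] at hkv
    rw [hu, mul_zero] at hku
    rw [hv, mul_one] at hkv
    rw [hu, mul_zero] at hkv
    dsimp only
    constructor <;> linarith
  · intro v
    have := (f v).isLt
    apply Fin.ext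
    have h1 := val_residue hp ((f v : ℤ) + p * k v)
    rw [Int.add_mul_emod_self_left, Int.emod_eq_of_lt (by omega) (by omega)] at h1
    dsimp only
    omega

/-- Where a lift exceeds another one, it can be lowered by one at some vertex. -/
theorem IsLift.exists_lower {V : Type u} [Finite V] {G : SimpleGraph V} {p q : ℕ}
    (h2 : 2 * q < p) {c : V → ℤ} {L M : V → ℤ} (hL : IsLift G p q c L) (hM : IsLift G p q c M)
    {x : V} (hx : M x < L x) [DecidableEq V] :
    ∃ v, M v < L v ∧ IsLift G p q c (Function.update L v (L v - 1)) := by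
  -- Subtracting `p * c` centres the allowed interval of differences. At a maximum, a neighbour
  -- where `L` exceeds `M` leaves slack because `p / 2` lies strictly between `q` and `p - q`; at
  -- any other neighbour the slack comes from `M`.
  obtain ⟨v, hv, hmax⟩ := Set.exists_max_image {v | M v < L v} (fun v => 2 * L v - p * c v)
    (Set.toFinite _) ⟨x, hx⟩
  refine ⟨v, hv, fun a b hab ha hb => ?_⟩
  have h1 := hL a b hab ha hb
  have h3 := hM a b hab ha hb
  have hv' : M v < L v := hv
  by_cases hav : a = v
  · subst hav
    rw [Function.update_self, Function.update_of_ne hab.ne.symm]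
    by_cases hbM : M b < L b
    · have := hmax b hbM
      rw [ha, hb] at this
      omega
    · omega
  · by_cases hbv : b = v
    · subst hbv
      rw [Function.update_self, Function.update_of_ne hab.ne]
      by_cases haM : M a < L a
      · have := hmax a haM
        rw [ha, hb] at this
        omega
      · omega
    · rw [Function.update_of_ne hav, Function.update_of_ne hbv]
      exact h1

theorem IsLift.reachable {V : Type u} [Finite V] {G : SimpleGraph V} {p q : ℕ} (hp : 0 < p)
    (hq : 0 < q) (h2 : 2 * q < p) {c : V → ℤ} (hc : ∀ v, c v = 0 ∨ c v = 1)
    (hc' : ∀ u v, G.Adj u v → c u ≠ c v) {L M : V → ℤ} (hL : IsLift G p q c L)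
    (hM : IsLift G p q c M) :
    (colGraph G (circularClique p q)).Reachable (hL.toHom hp hq hc hc')
      (hM.toHom hp hq hc hc') := by
  classical
  have := Fintype.ofFinite V
  have step : ∀ (N : V → ℤ) (hN : IsLift G p q c N) (v : V)
      (hN' : IsLift G p q c (Function.update N v (N v - 1))),
      (colGraph G (circularClique p q)).Reachable (hN.toHom hp hq hc hc')
        (hN'.toHom hp hq hc hc') := by
    intro N hN v hN'
    by_cases h : hN.toHom hp hq hc hc' = hN'.toHom hp hq hc hc'
    · rw [h]
    · refine SimpleGraph.Adj.reachable ⟨h, ?_⟩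
      refine Set.subsingleton_of_subset_singleton (a := v) fun w hw => ?_
      by_contra hwv
      apply hw
      change residue hp (N w) = residue hp (Function.update N v (N v - 1) w)
      rw [Function.update_of_ne hwv]
  have dist_lt : ∀ (N K : V → ℤ) (v : V), K v < N v →
      ∑ w, (Function.update N v (N v - 1) w - K w).natAbs < ∑ w, (N w - K w).natAbs := by
    intro N K v hv
    refine Finset.sum_lt_sum (fun w _ => ?_) ⟨v, Finset.mem_univ _, ?_⟩
    · by_cases hw : w = v
      · subst hw; rw [Function.update_self]; omega
      · rw [Function.update_of_ne hw]
    · rw [Function.update_self]; omega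
  induction hn : ∑ w, (L w - M w).natAbs using Nat.strong_induction_on generalizing L M with
  | _ n ih =>
    by_cases h : ∃ x, M x < L x
    · obtain ⟨x, hx⟩ := h
      obtain ⟨v, hv, hL'⟩ := hL.exists_lower h2 hM hx
      exact (step L hL v hL').trans (ih _ (hn ▸ dist_lt L M v hv) hL' hM rfl)
    · by_cases h' : ∃ x, L x < M x
      · obtain ⟨x, hx⟩ := h'
        obtain ⟨v, hv, hM'⟩ := hM.exists_lower h2 hL hx
        have hlt := dist_lt M L v hv
        have hsymm : ∀ N : V → ℤ, ∑ w, (N w - L w).natAbs = ∑ w, (L w - N w).natAbs :=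
          fun N => Finset.sum_congr rfl fun w _ => by omega
        rw [hsymm, hsymm, hn] at hlt
        exact (ih _ hlt hL hM' rfl).trans (step M hM v hM').symm
      · push Not at h h'
        obtain rfl : L = M := funext fun w => le_antisymm (h w) (h' w)
        rfl

theorem IsWindless.isMixing {V : Type u} [Finite V] {G : SimpleGraph V} {p q : ℕ} (hq : 0 < q)
    (h2 : 2 * q < p) (h : IsWindless p q G) : IsMixing p q G := by
  have hp : 0 < p := by omega
  obtain ⟨c, hc, hc'⟩ := IsBipartite.exists_int_coloring h.1
  have hlift : IsLift G p q c (fun v => q * c v) := by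
    intro u v _ hu hv
    dsimp only
    rw [hu, hv]
    omega
  have := Nonempty.intro (hlift.toHom hp hq hc hc')
  refine Connected.mk fun f g => ?_
  obtain ⟨L, hL, hf⟩ := (h.2 f).exists_isLift hp hq (c := c)
  obtain ⟨M, hM, hg⟩ := (h.2 g).exists_isLift hp hq (c := c)
  have hf' : f = hL.toHom hp hq hc hc' := DFunLike.ext _ _ hf
  have hg' : g = hM.toHom hp hq hc hc' := DFunLike.ext _ _ hg
  rw [hf', hg']
  exact hL.reachable hp hq h2 hc hc' hM

theorem isMixing_iff_isWindless {V : Type u} [Finite V] {G : SimpleGraph V} {p q : ℕ}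
    (hq : 0 < q) (h2 : 2 * q < p) (h4 : p < 4 * q) : IsMixing p q G ↔ IsWindless p q G :=
  ⟨fun h => h.isWindless hq h2 h4, fun h => h.isMixing hq h2⟩

/-! ### Folding preserves absence of wind. -/

theorem IsWindless.of_iso {V : Type u} {W : Type v} {G : SimpleGraph V} {H : SimpleGraph W}
    {p q : ℕ} (e : G ≃g H) (h : IsWindless p q G) : IsWindless p q H := by
  refine ⟨h.1.of_hom e.symm.toHom, fun f => ?_⟩
  obtain ⟨F, hF⟩ := h.2 (f.comp e.toHom)
  refine ⟨fun w => F (e.symm w), fun u v huv => ?_⟩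
  have := hF _ _ (e.symm.toHom.map_adj huv)
  simpa using this

theorem exists_adj_adj_of_dist_eq_two {V : Type u} {G : SimpleGraph V} {x y : V}
    (h : G.dist x y = 2) : ∃ z, G.Adj x z ∧ G.Adj z y := by
  have hr : G.Reachable x y := by
    by_contra hc
    rw [dist_eq_zero_of_not_reachable hc] at h
    omega
  obtain ⟨w, hw⟩ := hr.exists_walk_length_eq_dist
  rw [h] at hw
  cases w with
  | nil => simp at hw
  | cons h1 w =>
    cases w with
    | nil => simp at hw
    | cons h2 w =>
      cases w with
      | nil => exact ⟨_, h1, h2⟩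
      | cons h3 w => simp at hw

/-- A function identifying `x` and `y` descends to the identification. -/
def Identified.lift {V : Type u} {α : Type v} {x y : V} (F : V → α) (h : F x = F y) :
    Identified x y → α :=
  Quot.lift F fun _ _ hab => by rw [hab.1, hab.2, h]

theorem IsWindless.identify {V : Type u} {G : SimpleGraph V} {p q : ℕ} {x y : V}
    (hxy : G.dist x y = 2) (h : IsWindless p q G) : IsWindless p q (identify G x y) := by
  obtain ⟨z, hxz, hzy⟩ := exists_adj_adj_of_dist_eq_two hxy
  refine ⟨?_, fun f => ?_⟩
  · obtain ⟨c, hc, hc'⟩ := IsBipartite.exists_int_coloring h.1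
    have hcxy : c x = c y := by
      have h1 := hc' x z hxz
      have h2 := hc' z y hzy
      rcases hc x with h | h <;> rcases hc y with h' | h' <;> rcases hc z with h'' | h'' <;> omega
    let d : Identified x y → Bool := fun v => decide (Identified.lift c hcxy v = 0)
    refine (Coloring.mk d ?_).colorable
    rintro _ _ ⟨_, a, b, hab, rfl, rfl⟩
    have h1 : c a ≠ c b := hc' a b hab
    change decide (c a = 0) ≠ decide (c b = 0)
    rw [ne_eq, decide_eq_decide]
    rcases hc a with h | h <;> rcases hc b with h' | h' <;> omega
  · obtain ⟨F, hF⟩ := h.2 (f.comp (elementaryFold G x y hxy))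
    have hFxy : F x = F y := by
      have h1 := hF z x hxz.symm
      have h2 := hF z y hzy
      have h3 : (elementaryFold G x y hxy) x = (elementaryFold G x y hxy) y :=
        Quot.sound ⟨rfl, rfl⟩
      simp only [RelHom.comp_apply] at h1 h2
      rw [h3] at h1
      linarith
    refine ⟨Identified.lift F hFxy, ?_⟩
    rintro _ _ ⟨_, a, b, hab, rfl, rfl⟩
    exact hF a b hab

theorem IsWindless.of_foldsTo {V : Type u} {W : Type v} {G : SimpleGraph V} {H : SimpleGraph W}
    {p q : ℕ} (hGH : FoldsTo G H) (h : IsWindless p q G) : IsWindless p q H := by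
  obtain ⟨f, hf⟩ := hGH
  induction hf with
  | iso e => exact h.of_iso e
  | comp x y hxy f _ ih => exact ih (h.identify hxy)

/-! ### Maps to cycles and their lifts. -/

/-- `g` maps `G` to the cycle `ZMod n`, moving by one step along each edge. -/
def IsCyclic {V : Type u} (G : SimpleGraph V) {n : ℕ} (g : V → ZMod n) : Prop :=
  ∀ u v, G.Adj u v → g v = g u + 1 ∨ g u = g v + 1

/-- The map `g` to the cycle `ZMod n` lifts, up to translation, to the integers. -/
def LiftsToInt {V : Type u} (G : SimpleGraph V) {n : ℕ} (g : V → ZMod n) : Prop :=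
  ∃ F : V → ℤ, ∀ u v, G.Adj u v → g v = g u + 1 → F v = F u + 1

theorem dist_eq_two {V : Type u} {G : SimpleGraph V} {x y z : V} (hxy : x ≠ y)
    (hn : ¬ G.Adj x y) (hxz : G.Adj x z) (hzy : G.Adj z y) : G.dist x y = 2 := by
  have hle : G.dist x y ≤ 2 := dist_le (Walk.cons hxz (Walk.cons hzy Walk.nil))
  have h0 : G.dist x y ≠ 0 := fun h =>
    hxy (((hxz.reachable.trans hzy.reachable).dist_eq_zero_iff).1 h)
  have h1 : G.dist x y ≠ 1 := fun h => hn (dist_eq_one_iff_adj.1 h)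
  omega

theorem one_ne_zero_zmod {n : ℕ} (hn : 3 ≤ n) : (1 : ZMod n) ≠ 0 := by
  have : Fact (1 < n) := ⟨by omega⟩
  exact one_ne_zero

theorem IsCyclic.dist_eq_two {V : Type u} {G : SimpleGraph V} {n : ℕ} (hn : 3 ≤ n)
    {g : V → ZMod n} (hg : IsCyclic G g) {x y z : V} (hxy : x ≠ y) (hxz : G.Adj x z)
    (hzy : G.Adj z y) (h : g x = g y) : G.dist x y = 2 := by
  refine CircularMixing.dist_eq_two hxy (fun hadj => ?_) hxz hzy
  have h1 := one_ne_zero_zmod hn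
  rcases hg x y hadj with h' | h'
  · rw [h] at h'; exact h1 (by simpa using h')
  · rw [h] at h'; exact h1 (by simpa using h')

theorem card_identified_lt {V : Type u} [Finite V] {x y : V} (hxy : x ≠ y) :
    Nat.card (Identified x y) < Nat.card V := by
  have hs : Function.Surjective (Quot.mk _ : V → Identified x y) := Quot.mk_surjective
  refine lt_of_le_of_ne (Nat.card_le_card_of_surjective _ hs) fun h => hxy ?_
  have hb := (Nat.bijective_iff_surjective_and_card _).2 ⟨hs, h.symm⟩
  exact hb.1 (Quot.sound ⟨rfl, rfl⟩)

/-- A locally injective map of a connected graph to a cycle lifts to the integers if some vertex has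
no successor: the graph is then a path. -/
theorem IsCyclic.liftsToInt {V : Type u} {G : SimpleGraph V} (hG : G.Connected) {n : ℕ}
    {g : V → ZMod n} (hg : IsCyclic G g)
    (hinj : ∀ u x y, G.Adj u x → G.Adj u y → g x = g y → x = y) {r : V}
    (hr : ∀ v, G.Adj r v → g v ≠ g r + 1) : LiftsToInt G g := by
  -- `C i w` says that `i` successor steps lead from `w` to `r`. Successors are unique and `r` has
  -- none, so `i` is determined by `w`, and `-i` is the lift.
  let C : ℕ → V → Prop := fun i => Nat.rec (fun w => w = r)
    (fun _ P w => ∃ w', P w' ∧ G.Adj w w' ∧ g w' = g w + 1) i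
  have hex : ∀ w, ∃ i, C i w := by
    intro w
    obtain ⟨p⟩ := hG.preconnected w r
    induction p with
    | nil => exact ⟨0, rfl⟩
    | @cons u v _ h _ ih =>
      obtain ⟨i, hi⟩ := ih hr
      rcases hg u v h with h' | h'
      · exact ⟨i + 1, v, hi, h, h'⟩
      · cases i with
        | zero =>
          obtain rfl : v = _ := hi
          exact (hr u h.symm h').elim
        | succ i =>
          obtain ⟨w, hw, hvw, hgw⟩ := hi
          obtain rfl := hinj v u w h.symm hvw (h'.trans hgw.symm)
          exact ⟨i, hw⟩
  have huniq : ∀ i j w, C i w → C j w → i = j := by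
    intro i
    induction i with
    | zero =>
      intro j w hi hj
      cases j with
      | zero => rfl
      | succ j =>
        obtain ⟨w', _, h1, h2⟩ := hj
        obtain rfl : w = r := hi
        exact (hr w' h1 h2).elim
    | succ i ih =>
      intro j w hi hj
      obtain ⟨w', hC, h1, h2⟩ := hi
      cases j with
      | zero =>
        obtain rfl : w = r := hj
        exact (hr w' h1 h2).elim
      | succ j =>
        obtain ⟨w'', hC', h1', h2'⟩ := hj
        obtain rfl := hinj w w' w'' h1 h1' (h2.trans h2'.symm)
        rw [ih j w' hC hC']
  choose i hi using hex
  refine ⟨fun w => -(i w : ℤ), fun a b hab h => ?_⟩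
  have := huniq (i b + 1) (i a) a ⟨b, hi b, hab, h⟩ (hi a)
  dsimp only
  omega

/-! ### Graphs that are single cycles. -/

/-- A map of the cycle of length `m` to the cycle of even length `n ≤ m` that goes round once and
then oscillates. -/
def windOnce (n i : ℕ) : ℕ := if i < n then i else i % 2

theorem windOnce_succ {n : ℕ} (hn : Even n) (i : ℕ) :
    (i < n ∧ (windOnce n (i + 1) : ZMod n) = windOnce n i + 1) ∨
    (n ≤ i ∧ i % 2 = 0 ∧ (windOnce n (i + 1) : ZMod n) = windOnce n i + 1) ∨
    (n ≤ i ∧ i % 2 = 1 ∧ (windOnce n i : ZMod n) = windOnce n (i + 1) + 1) := by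
  obtain ⟨k, hk⟩ := hn
  unfold windOnce
  by_cases h1 : i + 1 < n
  · left
    rw [if_pos h1, if_pos (by omega)]
    exact ⟨by omega, by push_cast; rfl⟩
  · rw [if_neg h1]
    by_cases h2 : i < n
    · left
      refine ⟨h2, ?_⟩
      have e : i + 1 = n := by omega
      rw [if_pos h2, show (i + 1) % 2 = 0 by omega, ← Nat.cast_succ, Nat.succ_eq_add_one, e]
      simp
    · right
      rw [if_neg h2]
      rcases Nat.mod_two_eq_zero_or_one i with h | h
      · left
        rw [show (i + 1) % 2 = 1 by omega, h]
        exact ⟨by omega, rfl, by simp⟩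
      · right
        rw [show (i + 1) % 2 = 0 by omega, h]
        exact ⟨by omega, rfl, by simp⟩

/-- A single-cycle presentation of a graph. -/
structure CyclePresentation {V : Type u} (G : SimpleGraph V) (m : ℕ) where
  /-- the successor along the cycle -/
  next : V → V
  /-- a base point -/
  base : V
  next_injective : Function.Injective next
  adj_iff : ∀ u v, G.Adj u v ↔ v = next u ∨ u = next v
  minimalPeriod_eq : Function.minimalPeriod next base = m
  exists_iterate : ∀ v, ∃ i < m, next^[i] base = v

/-- Local injectivity makes the successor map injective, and the edges are exactly its steps. By
finiteness and connectedness it has a single periodic orbit; `g` grows by one per step, so `n`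
divides the period. -/
theorem IsCyclic.exists_cyclePresentation {V : Type u} [Finite V] {G : SimpleGraph V}
    (hG : G.Connected) {n : ℕ} {g : V → ZMod n} (hg : IsCyclic G g)
    (hinj : ∀ u x y, G.Adj u x → G.Adj u y → g x = g y → x = y)
    (hnext : ∀ u, ∃ v, G.Adj u v ∧ g v = g u + 1) :
    ∃ m, n ∣ m ∧ Nonempty (CyclePresentation G m) := by
  choose s hs hgs using hnext
  obtain ⟨r⟩ := hG.nonempty
  have hsinj : Function.Injective s := by
    intro a b hab
    refine hinj (s a) a b (hs a).symm (hab ▸ (hs b).symm) ?_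
    have h1 := hgs a
    rw [hab, hgs b] at h1
    exact (add_right_cancel h1).symm
  have hadj : ∀ u v, G.Adj u v ↔ v = s u ∨ u = s v := by
    intro u v
    constructor
    · intro h
      rcases hg u v h with h' | h'
      · exact Or.inl (hinj u v (s u) h (hs u) (h'.trans (hgs u).symm))
      · exact Or.inr (hinj v u (s v) h.symm (hs v) (h'.trans (hgs v).symm))
    · rintro (rfl | rfl)
      · exact hs u
      · exact (hs v).symm
  have hmem := hsinj.mem_periodicPts r
  have hpos := Function.minimalPeriod_pos_of_mem_periodicPts hmem
  have hper : s^[Function.minimalPeriod s r] r = r := Function.iterate_minimalPeriod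
  have hit : ∀ i, g (s^[i] r) = g r + i := by
    intro i
    induction i with
    | zero => simp
    | succ i ih => rw [Function.iterate_succ_apply', hgs, ih]; push_cast; ring
  refine ⟨Function.minimalPeriod s r, ?_, ⟨⟨s, r, hsinj, hadj, rfl, fun v => ?_⟩⟩⟩
  · have := hit (Function.minimalPeriod s r)
    rw [hper] at this
    rw [← ZMod.natCast_eq_zero_iff]
    simpa using this
  · suffices ∃ i, s^[i] r = v by
      obtain ⟨i, hi⟩ := this
      exact ⟨i % Function.minimalPeriod s r, Nat.mod_lt _ hpos,
        Function.iterate_mod_minimalPeriod_eq.trans hi⟩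
    obtain ⟨p⟩ := hG.preconnected v r
    induction p with
    | nil => exact ⟨0, rfl⟩
    | @cons u v r h _ ih =>
      obtain ⟨i, hi⟩ := ih hmem hpos hper hit
      rcases (hadj u v).1 h with h' | h'
      · refine ⟨i + (Function.minimalPeriod s r - 1), hsinj ?_⟩
        rw [← h', ← Function.iterate_succ_apply' s, ← hi]
        have e : (i + (Function.minimalPeriod s r - 1)).succ = i + Function.minimalPeriod s r := by
          omega
        rw [e, Function.iterate_add_apply, hper]
      · exact ⟨i + 1, by rw [Function.iterate_succ_apply', hi, h']⟩

namespace CyclePresentation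

variable {V : Type u} {G : SimpleGraph V} {m : ℕ} (P : CyclePresentation G m)

theorem iterate_inj {i j : ℕ} (hi : i < m) (hj : j < m)
    (h : P.next^[i] P.base = P.next^[j] P.base) : i = j :=
  Function.iterate_injOn_Iio_minimalPeriod (f := P.next) (x := P.base)
    (by rw [P.minimalPeriod_eq]; exact hi) (by rw [P.minimalPeriod_eq]; exact hj) h

theorem iterate_self : P.next^[m] P.base = P.base := by
  have := Function.iterate_minimalPeriod (f := P.next) (x := P.base)
  rwa [P.minimalPeriod_eq] at this

/-- The position of a vertex on the cycle. -/
noncomputable def index (v : V) : ℕ := (P.exists_iterate v).choose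

theorem index_lt (v : V) : P.index v < m := (P.exists_iterate v).choose_spec.1

theorem iterate_index (v : V) : P.next^[P.index v] P.base = v :=
  (P.exists_iterate v).choose_spec.2

theorem index_iterate {i : ℕ} (hi : i < m) : P.index (P.next^[i] P.base) = i :=
  P.iterate_inj (P.index_lt _) hi (P.iterate_index _)

theorem index_next (v : V) :
    (P.index v + 1 < m ∧ P.index (P.next v) = P.index v + 1) ∨
    (P.index v + 1 = m ∧ P.index (P.next v) = 0) := by
  have h : P.next v = P.next^[P.index v + 1] P.base := by
    rw [Function.iterate_succ_apply', P.iterate_index]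
  have hlt := P.index_lt v
  rcases Nat.lt_or_ge (P.index v + 1) m with h' | h'
  · exact Or.inl ⟨h', by rw [h, P.index_iterate h']⟩
  · have e : P.index v + 1 = m := by omega
    refine Or.inr ⟨e, ?_⟩
    rw [h, e, P.iterate_self]
    exact P.index_iterate (i := 0) (by omega)

theorem eq_next_iff (u v : V) : v = P.next u ↔
    (P.index v = P.index u + 1 ∨ (P.index u + 1 = m ∧ P.index v = 0)) := by
  have hu := P.index_lt u
  have hv := P.index_lt v
  have key : v = P.next u ↔ P.index v = P.index (P.next u) := by
    constructor
    · rintro rfl; rfl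
    · intro h; rw [← P.iterate_index v, h, P.iterate_index]
  rw [key]
  rcases P.index_next u with ⟨h1, h2⟩ | ⟨h1, h2⟩ <;> rw [h2] <;> omega

/-- A graph presented as a cycle is isomorphic to the standard cycle. -/
noncomputable def iso (hm : 3 ≤ m) : G ≃g cycleGraph m where
  toFun v := ⟨P.index v, P.index_lt v⟩
  invFun i := P.next^[(i : ℕ)] P.base
  left_inv v := P.iterate_index v
  right_inv i := Fin.ext (P.index_iterate i.isLt)
  map_rel_iff' := by
    intro u v
    obtain ⟨k, rfl⟩ : ∃ k, m = k + 2 := ⟨m - 2, by omega⟩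
    have hu := P.index_lt u
    have hv := P.index_lt v
    have key : ∀ a b : Fin (k + 2), a - b = 1 ↔
        ((a : ℕ) = b + 1 ∨ ((b : ℕ) + 1 = k + 2 ∧ (a : ℕ) = 0)) := by
      intro a b
      have ha := a.isLt
      have hb := b.isLt
      rw [sub_eq_iff_eq_add, Fin.ext_iff, Fin.val_add, Fin.val_one]
      rcases Nat.lt_or_ge (b + 1 : ℕ) (k + 2) with h | h
      · rw [Nat.mod_eq_of_lt (by omega)]; omega
      · rw [show 1 + (b : ℕ) = k + 2 by omega, Nat.mod_self]; omega
    rw [cycleGraph_adj, P.adj_iff, P.eq_next_iff, P.eq_next_iff]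
    exact Iff.trans (or_congr (key _ _) (key _ _)) or_comm

/-- The map winding once round the cycle of length `n`. -/
noncomputable def wind (n : ℕ) (v : V) : ZMod n := windOnce n (P.index v)

theorem wind_iterate {n : ℕ} (hnm : n < m) (hm : Even m) {i : ℕ} (hi : i ≤ m) :
    P.wind n (P.next^[i] P.base) = windOnce n i := by
  rcases Nat.lt_or_ge i m with h | h
  · rw [wind, P.index_iterate h]
  · obtain rfl : i = m := by omega
    obtain ⟨k, hk⟩ := hm
    rw [P.iterate_self, wind]
    have h0 : P.index P.base = 0 := P.index_iterate (i := 0) (by omega)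
    rw [h0]
    unfold windOnce
    rw [if_neg (by omega : ¬ i < n), show i % 2 = 0 by omega]
    split_ifs <;> simp

theorem wind_isCyclic {n : ℕ} (hn : Even n) (hnm : n < m) (hm : Even m) :
    IsCyclic G (P.wind n) := by
  have key : ∀ v, P.wind n (P.next v) = P.wind n v + 1 ∨
      P.wind n v = P.wind n (P.next v) + 1 := by
    intro v
    have h1 := P.wind_iterate hnm hm (P.index_lt v).le
    have h2 := P.wind_iterate hnm hm (i := P.index v + 1) (P.index_lt v)
    rw [Function.iterate_succ_apply', P.iterate_index] at h2
    rw [P.iterate_index] at h1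
    rw [h1, h2]
    rcases windOnce_succ hn (P.index v) with h | h | h
    · exact Or.inl h.2
    · exact Or.inl h.2.2
    · exact Or.inr h.2.2
  intro u v huv
  rcases (P.adj_iff u v).1 huv with rfl | rfl
  · exact key u
  · exact (key v).symm

theorem not_liftsToInt_wind {n : ℕ} (hn0 : 0 < n) (hn : Even n) (hnm : n < m) (hm : Even m) :
    ¬ LiftsToInt G (P.wind n) := by
  rintro ⟨F, hF⟩
  have hadj : ∀ v, G.Adj v (P.next v) := fun v => (P.adj_iff _ _).2 (Or.inl rfl)
  -- A lift climbs to `n` and then oscillates between `n` and `n + 1`, so it cannot return to its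
  -- initial value at `i = m`.
  have key : ∀ i ≤ m, F (P.next^[i] P.base) =
      F P.base + (if i < n then i else n + i % 2 : ℕ) := by
    intro i
    induction i with
    | zero => intro _; rw [if_pos hn0]; simp
    | succ i ih =>
      intro hi
      have ih := ih (by omega)
      have h1 := P.wind_iterate hnm hm (i := i) (by omega)
      have h2 := P.wind_iterate hnm hm hi
      have ha := hadj (P.next^[i] P.base)
      rw [Function.iterate_succ_apply'] at h2 ⊢
      obtain ⟨k, hk⟩ := hn
      rcases windOnce_succ ⟨k, hk⟩ i with ⟨h, h'⟩ | ⟨h, h'', h'⟩ | ⟨h, h'', h'⟩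
      · rw [← h1, ← h2] at h'
        have := hF _ _ ha h'
        split_ifs at ih ⊢ <;> omega
      · rw [← h1, ← h2] at h'
        have := hF _ _ ha h'
        split_ifs at ih ⊢ <;> omega
      · rw [← h1, ← h2] at h'
        have := hF _ _ ha.symm h'
        split_ifs at ih ⊢ <;> omega
  have := key m le_rfl
  rw [P.iterate_self] at this
  split_ifs at this <;> omega

end CyclePresentation

/-! ### Folding onto an even cycle. -/

/-- A connected graph with an essential map to an even cycle folds to that cycle. -/
theorem foldsTo_cycleGraph {n : ℕ} (hn : 3 ≤ n) (hev : Even n) {V : Type u} [Finite V]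
    {G : SimpleGraph V} (hG : G.Connected) {g : V → ZMod n} (hg : IsCyclic G g)
    (hl : ¬ LiftsToInt G g) : FoldsTo G (cycleGraph n) := by
  induction hN : Nat.card V using Nat.strong_induction_on generalizing V with
  | _ N ih =>
    -- Any essential map that is not locally injective allows a fold through which it descends,
    -- still essential. The map varies because `g` is replaced below when `G` is a long cycle.
    have fold : ∀ g' : V → ZMod n, IsCyclic G g' → ¬ LiftsToInt G g' → ∀ x y z, x ≠ y →
        G.Adj x z → G.Adj z y → g' x = g' y → FoldsTo G (cycleGraph n) := by
      intro g' hg' hl' x y z hxy hxz hzy hgxy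
      have hd := hg'.dist_eq_two hn hxy hxz hzy hgxy
      obtain ⟨f, hf⟩ := ih _ (hN ▸ card_identified_lt hxy) (G := identify G x y)
        (g := Identified.lift g' hgxy)
        (hG.map (elementaryFold G x y hd) Quot.mk_surjective)
        (by rintro _ _ ⟨_, a, b, hab, rfl, rfl⟩; exact hg' a b hab)
        (by
          rintro ⟨F, hF⟩
          exact hl' ⟨fun v => F (Quot.mk _ v), fun a b hab h =>
            hF _ _ ((elementaryFold G x y hd).map_adj hab) h⟩) rfl
      exact ⟨_, IsFolding.comp x y hd f hf⟩
    by_cases hinj : ∀ u x y, G.Adj u x → G.Adj u y → g x = g y → x = y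
    · by_cases hnext : ∀ u, ∃ v, G.Adj u v ∧ g v = g u + 1
      · obtain ⟨m, ⟨k, rfl⟩, ⟨P⟩⟩ := hg.exists_cyclePresentation hG hinj hnext
        rcases Nat.lt_trichotomy k 1 with hk | rfl | hk
        · have := P.index_lt P.base
          obtain rfl : k = 0 := by omega
          omega
        · rw [mul_one] at P
          exact ⟨_, IsFolding.iso (P.iso hn)⟩
        · have hnm : n + n ≤ n * k := by nlinarith
          have hm : Even (n * k) := hev.mul_right k
          obtain ⟨j, hj⟩ := id hev
          have hadj : ∀ v, G.Adj v (P.next v) := fun v => (P.adj_iff _ _).2 (Or.inl rfl)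
          -- On a cycle of length at least `2 * n`, `g` may be locally injective, but `P.wind n`
          -- oscillates after one turn and agrees at positions `n` and `n + 2`.
          refine fold (P.wind n) (P.wind_isCyclic hev (by omega) hm)
            (P.not_liftsToInt_wind (by omega) hev (by omega) hm)
            (P.next^[n] P.base) (P.next^[n + 2] P.base) (P.next^[n + 1] P.base)
            (fun h => ?_) ?_ ?_ ?_
          · have := P.iterate_inj (by omega) (by omega) h
            omega
          · rw [Function.iterate_succ_apply']; exact hadj _
          · rw [Function.iterate_succ_apply' _ (n + 1)]; exact hadj _
          · rw [P.wind_iterate (by omega) hm (by omega), P.wind_iterate (by omega) hm (by omega)]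
            unfold windOnce
            rw [if_neg (by omega), if_neg (by omega), Nat.add_mod_right]
      · push Not at hnext
        obtain ⟨r, hr⟩ := hnext
        exact (hl (hg.liftsToInt hG hinj hr)).elim
    · push Not at hinj
      obtain ⟨u, x, y, hx, hy, hgxy, hxy⟩ := hinj
      exact fold g hg hl x y u hxy hx.symm hy hgxy

/-! ### The case of odd cycles, `p = 2 * q + 1`. -/

theorem displacement_odd {q : ℕ} (hq : 0 < q) {a b : Fin (2 * q + 1)}
    (h : (circularClique (2 * q + 1) q).Adj a b) :
    displacement a b = 1 ∨ displacement a b = -1 := by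
  rw [circularClique_adj_iff hq] at h
  unfold displacement
  omega

/-- A colouring by an odd cycle together with a bipartition is a map to the cycle of twice the
length; if the colouring has wind, this map is essential. -/
theorem foldsTo_of_not_hasPotential {q : ℕ} (hq : 0 < q) {V : Type u} [Finite V]
    {G : SimpleGraph V} (hG : G.Connected) (hb : G.IsBipartite)
    {f : G →g circularClique (2 * q + 1) q} (hf : ¬ HasPotential f) :
    FoldsTo G (cycleGraph (4 * q + 2)) := by
  obtain ⟨c, hc, hc'⟩ := IsBipartite.exists_int_coloring hb
  -- The term in `c` changes by `±p` along each edge, which modulo `2 * p` matches the `-p` in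
  -- `displacement`.
  let g : V → ZMod (4 * q + 2) := fun v => ((2 * (f v : ℤ) + (2 * q + 1) * c v : ℤ) : ZMod _)
  have hgd : ∀ u v, G.Adj u v → g v = g u + (displacement (f u) (f v) : ℤ) := by
    intro u v huv
    simp only [g]
    rw [← Int.cast_add, ← sub_eq_zero, ← Int.cast_sub, ZMod.intCast_zmod_eq_zero_iff_dvd]
    unfold displacement
    have hcc := hc' u v huv
    rcases sub_emod_cases (f u) (f v) with ⟨_, e⟩ | ⟨_, e⟩ <;> rw [e] <;>
    rcases hc u with hu | hu <;> rcases hc v with hv | hv <;> rw [hu, hv] at hcc ⊢ <;>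
    first
    | exact (hcc rfl).elim
    | exact ⟨1, by push_cast; ring1⟩
    | exact ⟨0, by push_cast; ring1⟩
    | exact ⟨-1, by push_cast; ring1⟩
  refine foldsTo_cycleGraph (by omega) ⟨2 * q + 1, by ring⟩ hG (g := g) ?_ ?_
  · intro u v huv
    have h := hgd u v huv
    rcases displacement_odd hq (f.map_adj huv) with e | e <;> rw [e] at h
    · left; simpa using h
    · right; rw [h]; simp
  · rintro ⟨F, hF⟩
    refine hf ⟨F, fun u v huv => ?_⟩
    have h := hgd u v huv
    rcases displacement_odd hq (f.map_adj huv) with e | e <;> rw [e] at h ⊢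
    · have := hF u v huv (by simpa using h)
      omega
    · have := hF v u huv.symm (by rw [h]; simp)
      omega

theorem not_isWindless_cycleGraph {q : ℕ} (hq : 0 < q) :
    ¬ IsWindless (2 * q + 1) q (cycleGraph (4 * q + 2)) := by
  intro h
  have hp : 0 < 2 * q + 1 := by omega
  have hper : ∀ k : ℤ, residue hp (q * (k + (4 * q + 2))) = residue hp (q * k) := by
    intro k
    apply Fin.ext
    have h1 := val_residue hp (q * (k + (4 * q + 2)))
    have h2 := val_residue hp (q * k)
    have e : (q : ℤ) * (k + (4 * q + 2)) = q * k + ((2 * q + 1 : ℕ) : ℤ) * (2 * q) := by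
      push_cast; ring
    rw [e, Int.add_mul_emod_self_left, ← h2, ← e] at h1
    exact_mod_cast h1
  -- Each step of `q` has displacement `2 * q - p = -1`, so a potential would drop by `4 * q + 2`
  -- round the cycle.
  let φ : Fin (4 * q + 2) → Fin (2 * q + 1) := fun i => residue hp (q * ((i : ℕ) : ℤ))
  have hstep : ∀ i : Fin (4 * q + 2), φ (i + 1) = residue hp (q * (((i : ℕ) : ℤ) + 1)) := by
    intro i
    have hi := i.isLt
    simp only [φ]
    rw [Fin.val_add, Fin.val_one]
    rcases Nat.lt_or_ge (i + 1 : ℕ) (4 * q + 2) with h' | h'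
    · rw [Nat.mod_eq_of_lt h']; push_cast; rfl
    · have e : (i : ℕ) + 1 = 4 * q + 2 := by omega
      have e' : ((i : ℕ) : ℤ) + 1 = 0 + (4 * q + 2) := by omega
      rw [e, Nat.mod_self, e', hper]
      rfl
  have hadj : ∀ i, (circularClique (2 * q + 1) q).Adj (φ i) (φ (i + 1)) := by
    intro i
    rw [hstep]
    exact adj_residue hp hq (by ring_nf; omega) (by push_cast; ring_nf; omega)
  have hdisp : ∀ i, displacement (φ i) (φ (i + 1)) = -1 := by
    intro i
    unfold displacement
    rw [hstep]
    simp only [φ]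
    rw [val_residue, val_residue, ← Int.sub_emod, Int.emod_eq_of_lt] <;> ring_nf <;>
      push_cast <;> omega
  let f : cycleGraph (4 * q + 2) →g circularClique (2 * q + 1) q :=
    { toFun := φ
      map_rel' := by
        intro a b hab
        rcases cycleGraph_adj.1 hab with h' | h'
        · obtain rfl : a = b + 1 := by rw [← h']; abel
          exact (hadj b).symm
        · obtain rfl : b = a + 1 := by rw [← h']; abel
          exact hadj a }
  obtain ⟨F, hF⟩ := h.2 f
  have hF1 : ∀ i, F (i + 1) = F i - 1 := by
    intro i
    have h1 := hF i (i + 1) (cycleGraph_adj.2 (Or.inr (by abel)))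
    have h2 : displacement (f i) (f (i + 1)) = -1 := hdisp i
    rw [h2] at h1
    omega
  have hFk : ∀ k : ℕ, F (k • (1 : Fin (4 * q + 2))) = F 0 - k := by
    intro k
    induction k with
    | zero => simp
    | succ k ih => rw [succ_nsmul, hF1, ih]; push_cast; ring
  have hcycle : (4 * q + 2) • (1 : Fin (4 * q + 2)) = 0 := by
    simpa using card_nsmul_eq_zero (x := (1 : Fin (4 * q + 2)))
  have := hFk (4 * q + 2)
  rw [hcycle] at this
  omega

end CircularMixing

theorem theorem2p4 (p q : ℕ) (hlo : (2 : ℚ) < (p : ℚ) / (q : ℚ)) (hhi : (p : ℚ) / (q : ℚ) < 4)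
    {V : Type u} [Finite V] (G : SimpleGraph V) :
    (∀ {W : Type v} [Finite W] (H : SimpleGraph W),
      CircularMixing.FoldsTo G H →
        ¬ CircularMixing.IsMixing p q H → ¬ CircularMixing.IsMixing p q G) ∧
    (p = 2 * q + 1 → G.Connected → G.IsBipartite →
      (CircularMixing.IsMixing p q G ↔
        ¬ CircularMixing.FoldsTo G (SimpleGraph.cycleGraph (4 * q + 2)))) := by
  have hq : 0 < q := by
    rcases Nat.eq_zero_or_pos q with rfl | h
    · norm_num at hlo
    · exact h
  have hq' : (0 : ℚ) < q := by exact_mod_cast hq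
  have h2 : 2 * q < p := by
    rw [lt_div_iff₀ hq'] at hlo
    exact_mod_cast hlo
  have h4 : p < 4 * q := by
    rw [div_lt_iff₀ hq'] at hhi
    exact_mod_cast hhi
  refine ⟨fun H hGH hH hG => hH ?_, ?_⟩
  · rw [CircularMixing.isMixing_iff_isWindless hq h2 h4] at hG ⊢
    exact hG.of_foldsTo hGH
  · rintro rfl hG hb
    rw [CircularMixing.isMixing_iff_isWindless hq h2 h4]
    refine ⟨fun h hfold => CircularMixing.not_isWindless_cycleGraph hq (h.of_foldsTo hfold),
      fun h => ⟨hb, fun f => ?_⟩⟩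
    by_contra hf
    exact h (CircularMixing.foldsTo_of_not_hasPotential hq hG hb hf)
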